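/- **Proposition 4.4.** All rings are commutative and unital. Let $R$ be a semi-local ring (a ring with finitely many maximal ideals) in which $2$ is invertible, and let $S$ be a finite étale $R$-algebra of constant degree (rank) $3$. Let $(V,q)$ be a quadratic space over $R$ of arbitrary finite rank; that is, $V$ is a free $R$-module of finite rank and $q\colon V\to R$ is a quadratic form such that $v\mapsto b_q(v,-)$, where $b_q(v,w)=q(v+w)-q(v)-q(w)$, is a bijection from $V$ onto $V^*=\operatorname{Hom}_R(V,R)$. Let $(V_S,q_S)$ denote its base change to $S$, with $V_S=V\otimes_R S$. Call a quadratic space $(W,p)$ over a ring $A$ isotropic if there is a unimodular vector $w\in W$ (one with $\lambda(w)=1$ for some $\lambda\in\operatorname{Hom}_A(W,A)$; equivalently, $w$ is a basis of a free rank-one direct summand of $W$) such that $p(w)=0$, and anisotropic otherwise. If $(V,q)$ is anisotropic over $R$, then $(V_S,q_S)$ is anisotropic over $S$. -/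

import Mathlib

open scoped TensorProduct

/-- A commutative ring is semi-local if it has only finitely many maximal ideals. -/
def IsSemiLocalRing (R : Type*) [CommRing R] : Prop :=
  Finite (MaximalSpectrum R)

/-- A quadratic form `q` on `V` is non-degenerate if `v ↦ b_q(v, -)` is a bijection from `V` onto
its dual, where `b_q(v, w) = q (v + w) - q v - q w`. -/
def QuadraticForm.IsNondegenerate {R V : Type*} [CommRing R] [AddCommGroup V] [Module R V]
    (q : QuadraticForm R V) : Prop :=
  Function.Bijective (QuadraticMap.polarBilin q : V →ₗ[R] V →ₗ[R] R)

/-- The pair `(V, q)` is a (free) quadratic space over `R`: the module `V` is free of finite rank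
and `q` is non-degenerate. -/
structure QuadraticForm.IsQuadraticSpace {R V : Type*} [CommRing R] [AddCommGroup V] [Module R V]
    (q : QuadraticForm R V) : Prop where
  free : Module.Free R V
  finite : Module.Finite R V
  nondegenerate : q.IsNondegenerate

/-- A vector `v` is unimodular if some linear form takes the value `1` at `v`; equivalently,
`v` is a basis of a free rank-one direct summand of `V`. For `V` free of finite rank this says that
`v` has non-zero image in the reduction of `V` modulo every maximal ideal of `R`. -/
def IsUnimodularVector (R : Type*) {V : Type*} [CommRing R] [AddCommGroup V] [Module R V]
    (v : V) : Prop :=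
  ∃ f : Module.Dual R V, f v = 1

/-- The form `q` is (strictly) isotropic if it vanishes at some unimodular vector. -/
def QuadraticForm.IsIsotropic {R V : Type*} [CommRing R] [AddCommGroup V] [Module R V]
    (q : QuadraticForm R V) : Prop :=
  ∃ v : V, IsUnimodularVector R v ∧ q v = 0

/-- The form `q` is (strictly) anisotropic if it is not (strictly) isotropic. -/
def QuadraticForm.IsStrictlyAnisotropic {R V : Type*} [CommRing R] [AddCommGroup V] [Module R V]
    (q : QuadraticForm R V) : Prop :=
  ¬ q.IsIsotropic

/-- `S` is a finite étale extension of `R` of (constant) degree `n`: it is an étale `R`-algebra,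
finite as a module, whose (locally free) underlying `R`-module has rank `n` at every prime. -/
structure IsFiniteEtaleOfDegree (R S : Type*) [CommRing R] [CommRing S] [Algebra R S]
    (n : ℕ) : Prop where
  etale : Algebra.Etale R S
  finite : Module.Finite R S
  rank_eq : ∀ p : PrimeSpectrum R, Module.rankAtStalk (R := R) S p = n

/-- A finite étale algebra of dimension `3` over a field of characteristic different from `2` is
generated by a single element. -/
theorem exists_linearIndependent_pow_of_etale_of_finrank_eq_three {K A : Type*} [Field K]
    [CommRing A] [Algebra K A] [Algebra.Etale K A] (h2 : (2 : K) ≠ 0)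
    (h3 : Module.finrank K A = 3) :
    ∃ x : A, LinearIndependent K (fun i : Fin 3 ↦ x ^ (i : ℕ)) := by
  classical
  obtain ⟨I, _, F, _, _, e, hF⟩ := (Algebra.Etale.iff_exists_algEquiv_prod K A).mp ‹_›
  have := Fintype.ofFinite I
  have hfin (i) : Module.Finite K (F i) := (hF i).1
  have hsep (i) : Algebra.IsSeparable K (F i) := (hF i).2
  have hsum : ∑ i, Module.finrank K (F i) = 3 := by
    rw [← Module.finrank_pi_fintype, ← e.toLinearEquiv.finrank_eq, h3]
  have hpos (i) : 1 ≤ Module.finrank K (F i) := Module.finrank_pos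
  have hcard : Fintype.card I ≤ 3 := by
    rw [← hsum, Fintype.card_eq_sum_ones]
    exact Finset.sum_le_sum fun i _ ↦ hpos i
  have hinj : Function.Injective (![0, 1, -1] : Fin 3 → K) := by
    have : (1 : K) ≠ -1 := fun h ↦ h2 (by linear_combination h)
    intro i j hij
    fin_cases i <;> fin_cases j <;> simp_all [eq_comm]
  obtain ⟨g⟩ : Nonempty (I ↪ Fin 3) :=
    Function.Embedding.nonempty_of_card_le (by simpa using hcard)
  let c : I → K := fun i ↦ ![0, 1, -1] (g i)
  have hc : Function.Injective c := hinj.comp g.injective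
  choose p hp using fun i ↦ Field.exists_primitive_element K (F i)
  let α : ∀ i, F i := fun i ↦ if Module.finrank K (F i) = 1 then algebraMap K (F i) (c i) else p i
  have hint (i) : IsIntegral K (α i) := Algebra.IsIntegral.isIntegral _
  have hdeg (i) : (minpoly K (α i)).natDegree = Module.finrank K (F i) := by
    by_cases h : Module.finrank K (F i) = 1
    · simp only [α, if_pos h, minpoly.eq_X_sub_C, Polynomial.natDegree_X_sub_C, h]
    · simp only [α, if_neg h]
      exact (Field.primitive_element_iff_minpoly_natDegree_eq K (p i)).mp (hp i)
  have hne : Pairwise fun i j ↦ minpoly K (α i) ≠ minpoly K (α j) := by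
    intro i j hij h
    have hd : Module.finrank K (F i) = Module.finrank K (F j) := by rw [← hdeg, ← hdeg, h]
    have hle : Module.finrank K (F i) + Module.finrank K (F j) ≤ 3 := by
      rw [← hsum, ← Finset.sum_pair (f := fun i ↦ Module.finrank K (F i)) hij]
      exact Finset.sum_le_sum_of_subset (Finset.subset_univ _)
    have hi : Module.finrank K (F i) = 1 := by have := hpos i; omega
    have hj : Module.finrank K (F j) = 1 := hd ▸ hi
    simp only [α, if_pos hi, if_pos hj, minpoly.eq_X_sub_C] at h
    exact hij (hc (Polynomial.C_injective (sub_right_injective h)))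
  have hcop : Pairwise fun i j ↦ IsCoprime (minpoly K (α i)) (minpoly K (α j)) := by
    intro i j hij
    refine (minpoly.irreducible (hint i)).coprime_iff_not_dvd.mpr fun h ↦ hne hij ?_
    exact Polynomial.eq_of_monic_of_associated (minpoly.monic (hint i)) (minpoly.monic (hint j))
      ((minpoly.irreducible (hint i)).associated_of_dvd (minpoly.irreducible (hint j)) h)
  refine ⟨e.symm α, ?_⟩
  rw [Fintype.linearIndependent_iff]
  intro a ha
  let P : Polynomial K := ∑ i : Fin 3, Polynomial.C (a i) * Polynomial.X ^ (i : ℕ)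
  have hP : Polynomial.aeval α P = 0 := by
    have := congrArg e ha
    simpa [P, Algebra.smul_def] using this
  have hdvd : ∏ i, minpoly K (α i) ∣ P := by
    refine Finset.prod_dvd_of_coprime (fun i _ j _ hij ↦ hcop hij) fun i _ ↦ minpoly.dvd _ _ ?_
    rw [← Polynomial.aeval_pi_apply₂, hP, Pi.zero_apply]
  have hPdeg : P.degree < 3 := Polynomial.degree_sum_fin_lt a
  have hP0 : P = 0 := by
    refine Polynomial.eq_zero_of_dvd_of_degree_lt hdvd (hPdeg.trans_le ?_)
    rw [Polynomial.degree_eq_natDegree (Finset.prod_ne_zero_iff.mpr fun i _ ↦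
      minpoly.ne_zero (hint i)), Polynomial.natDegree_prod _ _ fun i _ ↦ minpoly.ne_zero (hint i),
      Finset.sum_congr rfl fun i _ ↦ hdeg i, hsum]
    rfl
  intro i
  have := congrArg (Polynomial.coeff · (i : ℕ)) hP0
  simpa [P, Polynomial.finsetSum_coeff, Polynomial.coeff_C_mul, Polynomial.coeff_X_pow,
    Fin.val_inj] using this

/-- A finite étale algebra of degree `3` over a semi-local ring in which `2` is invertible has a
power basis. -/
theorem IsFiniteEtaleOfDegree.exists_basis_pow {R S : Type*} [CommRing R] [CommRing S]
    [Algebra R S] [Invertible (2 : R)] (hR : IsSemiLocalRing R)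
    (hS : IsFiniteEtaleOfDegree R S 3) :
    ∃ (x : S) (b : Module.Basis (Fin 3) R S), ∀ i, b i = x ^ (i : ℕ) := by
  classical
  have : Finite (MaximalSpectrum R) := hR
  have := hS.etale
  have := hS.finite
  let := @Ideal.Quotient.field
  have hrk (P : MaximalSpectrum R) :
      Module.finrank (R ⧸ P.asIdeal) ((R ⧸ P.asIdeal) ⊗[R] S) = 3 := by
    have h := Module.rankAtStalk_baseChange (R := R) (M := S) (⊥ : PrimeSpectrum (R ⧸ P.asIdeal))
    rw [hS.rank_eq, Module.rankAtStalk_eq_finrank_of_free] at h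
    exact_mod_cast h
  obtain ⟨b⟩ := Module.nonempty_basis_of_flat_of_finrank_eq R S 3 hrk
  have h2 (P : MaximalSpectrum R) : (2 : R ⧸ P.asIdeal) ≠ 0 := by
    have := (isUnit_of_invertible (2 : R)).map (algebraMap R (R ⧸ P.asIdeal))
    rw [map_ofNat] at this
    exact this.ne_zero
  choose y hy using fun P : MaximalSpectrum R ↦
    exists_linearIndependent_pow_of_etale_of_finrank_eq_three (K := R ⧸ P.asIdeal)
      (A := (R ⧸ P.asIdeal) ⊗[R] S) (h2 P) (hrk P)
  obtain ⟨x, hx⟩ := Ideal.pi_tensorProductMk_quotient_surjective S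
    (fun P : MaximalSpectrum R ↦ P.asIdeal)
    (fun _ _ ne ↦ Ideal.isCoprime_of_isMaximal (MaximalSpectrum.ext_iff.ne.mp ne)) y
  have hxy (P : MaximalSpectrum R) : (1 : R ⧸ P.asIdeal) ⊗ₜ[R] x = y P := congrFun hx P
  let v : Fin 3 → S := fun i ↦ x ^ (i : ℕ)
  have hdet : IsUnit (b.det v) := by
    by_contra h
    obtain ⟨m, hm, hmem⟩ := exists_max_ideal_of_mem_nonunits h
    let P : MaximalSpectrum R := ⟨m, hm⟩
    let b' := b.baseChange (R ⧸ P.asIdeal)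
    have hspan : IsUnit (b'.det fun i : Fin 3 ↦ y P ^ (i : ℕ)) := by
      rw [← Module.Basis.is_basis_iff_det]
      exact ⟨hy P, (hy P).span_eq_top_of_card_eq_finrank' (by simp [hrk P])⟩
    have heq : b'.det (fun i : Fin 3 ↦ y P ^ (i : ℕ)) = algebraMap R (R ⧸ P.asIdeal) (b.det v) := by
      rw [Module.Basis.det_apply, Module.Basis.det_apply, RingHom.map_det]
      congr 1
      ext i j
      simp [Module.Basis.toMatrix_apply, b', ← hxy, v, Algebra.TensorProduct.tmul_pow,
        Algebra.smul_def]
    rw [heq, Ideal.Quotient.algebraMap_eq, Ideal.Quotient.eq_zero_iff_mem.mpr hmem] at hspan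
    exact not_isUnit_zero hspan
  obtain ⟨hli, hsp⟩ := (Module.Basis.is_basis_iff_det b).mpr hdet
  exact ⟨x, Module.Basis.mk hli hsp.ge, fun i ↦ by simp [v]⟩

open QuadraticMap (polar polarBilin)

section Congruences

variable {A U : Type*} [CommRing A] [AddCommGroup U] [Module A U]

theorem isUnit_of_forall_maximalSpectrum_notMem {a : A}
    (h : ∀ m : MaximalSpectrum A, a ∉ m.asIdeal) : IsUnit a := by
  by_contra ha
  obtain ⟨m, hm, hmem⟩ := exists_max_ideal_of_mem_nonunits ha
  exact h ⟨m, hm⟩ hmem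

/-- Chinese remainder theorem for elements of a module over a semi-local ring. -/
theorem exists_forall_sub_mem_smul_top [Finite (MaximalSpectrum A)] (v : MaximalSpectrum A → U) :
    ∃ u : U, ∀ m, u - v m ∈ m.asIdeal • (⊤ : Submodule A U) := by
  classical
  have := Fintype.ofFinite (MaximalSpectrum A)
  choose ε hε using fun m : MaximalSpectrum A ↦ Ideal.exists_forall_sub_mem_ideal
    (I := fun m : MaximalSpectrum A ↦ m.asIdeal)
    (fun _ _ ne ↦ Ideal.isCoprime_of_isMaximal (MaximalSpectrum.ext_iff.ne.mp ne))
    (Pi.single m (1 : A))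
  refine ⟨∑ n, ε n • v n, fun m ↦ ?_⟩
  have h : ∑ n, ε n • v n - v m = ∑ n, (ε n - (Pi.single n 1 : MaximalSpectrum A → A) m) • v n := by
    simp [sub_smul, Pi.single_apply, ite_smul]
  rw [h]
  exact Submodule.sum_mem _ fun n _ ↦ Submodule.smul_mem_smul (hε n m) trivial

theorem Module.Dual.apply_mem_of_mem_smul_top {I : Ideal A} {w : U} (f : Module.Dual A U)
    (hw : w ∈ I • (⊤ : Submodule A U)) : f w ∈ I := by
  induction hw using Submodule.smul_induction_on' with
  | smul r hr n _ => simpa using I.mul_mem_right _ hr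
  | add x _ y _ hx hy => simpa using I.add_mem hx hy

namespace QuadraticForm

variable (q : QuadraticForm A U) {I : Ideal A}

theorem apply_add (x y : U) : q (x + y) = q x + q y + polar q x y :=
  QuadraticMap.map_add q x y

theorem polar_mem_of_mem_smul_top_right {w : U} (y : U) (hw : w ∈ I • (⊤ : Submodule A U)) :
    polar q y w ∈ I :=
  Module.Dual.apply_mem_of_mem_smul_top (polarBilin q y) hw

theorem polar_mem_of_mem_smul_top_left {w : U} (y : U) (hw : w ∈ I • (⊤ : Submodule A U)) :
    polar q w y ∈ I := by
  rw [QuadraticMap.polar_comm]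
  exact polar_mem_of_mem_smul_top_right q y hw

theorem apply_mem_of_mem_smul_top [Invertible (2 : A)] {w : U}
    (hw : w ∈ I • (⊤ : Submodule A U)) : q w ∈ I := by
  have h : q w = ⅟2 * polar q w w := by simp
  rw [h]
  exact I.mul_mem_left _ (polar_mem_of_mem_smul_top_left q w hw)

theorem apply_sub_apply_mem [Invertible (2 : A)] {u v : U}
    (h : u - v ∈ I • (⊤ : Submodule A U)) : q u - q v ∈ I := by
  obtain ⟨w, rfl⟩ : ∃ w, u = v + w := ⟨u - v, by abel⟩
  rw [add_sub_cancel_left] at h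
  rw [apply_add, add_assoc, add_sub_cancel_left]
  exact I.add_mem (apply_mem_of_mem_smul_top q h) (polar_mem_of_mem_smul_top_right q v h)

theorem polar_sub_polar_mem {u v u' v' : U} (h : u - v ∈ I • (⊤ : Submodule A U))
    (h' : u' - v' ∈ I • (⊤ : Submodule A U)) : polar q u u' - polar q v v' ∈ I := by
  have : polar q u u' - polar q v v' = polar q (u - v) u' + polar q v (u' - v') := by
    rw [QuadraticMap.polar_sub_left, QuadraticMap.polar_sub_right]; ring
  rw [this]
  exact I.add_mem (polar_mem_of_mem_smul_top_left q _ h) (polar_mem_of_mem_smul_top_right q _ h')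

/-- If `e` is isotropic and `polar q e z` is invertible, then moving `z` along `e` makes it
isotropic. -/
theorem apply_sub_smul_eq_zero {e z : U} (he : q e = 0) {t : A} (ht : polar q e z * t = 1) :
    q (z - (q z * t) • e) = 0 := by
  rw [sub_eq_add_neg, ← neg_smul, apply_add, QuadraticMap.map_smul, he,
    QuadraticMap.polar_smul_right, QuadraticMap.polar_comm, smul_eq_mul, smul_eq_mul]
  linear_combination -q z * ht

/-- Modulo a maximal ideal, there is an isotropic vector which is orthogonal neither to the
isotropic vector `e` nor to the isotropic vector `w`. -/
theorem exists_isotropic_not_orthogonal_mod [Invertible (2 : A)] {M : Ideal A} [M.IsMaximal]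
    {e w h d y : U} (hey : polar q e y = 1) (hw : q w ∈ M)
    (hh : q h ∈ M) (hwh : polar q w h - 1 ∈ M) (hdw : polar q d w ∈ M) (hdh : polar q d h ∈ M)
    (hd : q d ∉ M) : ∃ z : U, q z ∈ M ∧ polar q e z ∉ M ∧ polar q w z ∉ M := by
  let := Ideal.Quotient.field M
  have h2 : (2 : A ⧸ M) ≠ 0 := by
    have := (isUnit_of_invertible (2 : A)).map (Ideal.Quotient.mk M)
    rw [map_ofNat] at this
    exact this.ne_zero
  have hww : polar q w w = 2 * q w := by simp [two_smul, two_mul]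
  have hhh : polar q h h = 2 * q h := by simp [two_smul, two_mul]
  have key (u : U) (hu : polar q u w ∈ M) (hu' : polar q u h ∈ M)
      (hz : polar q e (h + (-q u) • w + u) ∉ M) :
      ∃ z : U, q z ∈ M ∧ polar q e z ∉ M ∧ polar q w z ∉ M := by
    refine ⟨_, ?_, hz, ?_⟩ <;>
    · simp only [apply_add, QuadraticMap.map_smul, QuadraticMap.polar_add_left,
        QuadraticMap.polar_add_right, QuadraticMap.polar_smul_left, QuadraticMap.polar_smul_right,
        hww, QuadraticMap.polar_comm q h w, QuadraticMap.polar_comm q w u,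
        QuadraticMap.polar_comm q h u, smul_eq_mul]
      rw [← Ideal.Quotient.eq_zero_iff_mem] at *
      simp only [map_add, map_mul, map_neg, map_sub, map_one, sub_eq_zero] at *
      simp [*]
  by_cases heh : polar q e h ∈ M
  · by_cases hew : polar q e w ∈ M
    · have hu : polar q (y + (-polar q y h) • w + (-polar q y w) • h) w ∈ M := by
        simp only [QuadraticMap.polar_add_left, QuadraticMap.polar_smul_left, smul_eq_mul,
          hww, QuadraticMap.polar_comm q h w]
        rw [← Ideal.Quotient.eq_zero_iff_mem] at *
        simp only [map_add, map_mul, map_neg, map_sub, map_one, sub_eq_zero] at *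
        simp [*]
      have hu' : polar q (y + (-polar q y h) • w + (-polar q y w) • h) h ∈ M := by
        simp only [QuadraticMap.polar_add_left, QuadraticMap.polar_smul_left, smul_eq_mul,
          hhh]
        rw [← Ideal.Quotient.eq_zero_iff_mem] at *
        simp only [map_add, map_mul, map_neg, map_sub, map_one, sub_eq_zero] at *
        simp [*]
      refine key _ hu hu' ?_
      generalize q (y + (-polar q y h) • w + (-polar q y w) • h) = a
      simp only [QuadraticMap.polar_add_right, QuadraticMap.polar_smul_right, smul_eq_mul]
      rw [← Ideal.Quotient.eq_zero_iff_mem] at *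
      simp only [map_add, map_mul, map_neg, map_sub, map_one, sub_eq_zero] at *
      simp [*]
    · by_cases hed : polar q e (h + (-q d) • w + d) ∈ M
      · refine key (-d) (by simpa using hdw) (by simpa using hdh) fun hed' ↦ ?_
        simp only [QuadraticMap.polar_add_right, QuadraticMap.polar_smul_right, smul_eq_mul,
          QuadraticMap.polar_neg_right, QuadraticMap.map_neg] at hed hed'
        rw [← Ideal.Quotient.eq_zero_iff_mem] at *
        simp only [map_add, map_mul, map_neg, map_sub, map_one, sub_eq_zero] at *
        have : (2 : A ⧸ M) * (Ideal.Quotient.mk M (q d) * Ideal.Quotient.mk M (polar q e w)) = 0 := by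
          linear_combination 2 * heh - hed - hed'
        simp_all
      · exact key d hdw hdh hed
  · refine ⟨h, hh, heh, fun hc ↦ ?_⟩
    exact (Ideal.ne_top_iff_one M).mp Ideal.IsPrime.ne_top' (by simpa using M.sub_mem hc hwh)

/-- Over a semi-local ring, an approximately isotropic vector `w` can be moved by a multiple of
`q w` to an isotropic one, provided that `q` has a unimodular isotropic vector and that `w` is
part of an approximately hyperbolic pair which has a non-degenerate complement. -/
theorem exists_apply_sub_smul_eq_zero [Invertible (2 : A)] [Finite (MaximalSpectrum A)]
    {e w h d y : U} (he : q e = 0) (hey : polar q e y = 1)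
    (hw : ∀ M : MaximalSpectrum A, q w ∈ M.asIdeal)
    (hh : ∀ M : MaximalSpectrum A, q h ∈ M.asIdeal)
    (hwh : ∀ M : MaximalSpectrum A, polar q w h - 1 ∈ M.asIdeal)
    (hdw : ∀ M : MaximalSpectrum A, polar q d w ∈ M.asIdeal)
    (hdh : ∀ M : MaximalSpectrum A, polar q d h ∈ M.asIdeal)
    (hd : ∀ M : MaximalSpectrum A, q d ∉ M.asIdeal) :
    ∃ (t : A) (z : U), q (w - (q w * t) • z) = 0 := by
  choose z₀ hz₀ hez₀ hwz₀ using fun M : MaximalSpectrum A ↦ exists_isotropic_not_orthogonal_mod q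
    hey (hw M) (hh M) (hwh M) (hdw M) (hdh M) (hd M)
  obtain ⟨z, hz⟩ := exists_forall_sub_mem_smul_top z₀
  have hqz (M : MaximalSpectrum A) : q z ∈ M.asIdeal := by
    simpa using add_mem (apply_sub_apply_mem q (hz M)) (hz₀ M)
  have hpol (x : U) (M : MaximalSpectrum A) (hx : polar q x (z₀ M) ∉ M.asIdeal) :
      polar q x z ∉ M.asIdeal := fun hc ↦ hx <| by
    have := polar_sub_polar_mem q (u := x) (v := x) (I := M.asIdeal) (by simp) (hz M)
    simpa using sub_mem hc this
  obtain ⟨t, ht⟩ := (isUnit_of_forall_maximalSpectrum_notMem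
    fun M ↦ hpol e M (hez₀ M)).exists_right_inv
  let z' := z - (q z * t) • e
  have hwz' (M : MaximalSpectrum A) : polar q z' w ∉ M.asIdeal := fun hc ↦ by
    refine hpol w M (hwz₀ M) ?_
    simp only [z', QuadraticMap.polar_sub_left, QuadraticMap.polar_smul_left, smul_eq_mul] at hc
    rw [QuadraticMap.polar_comm]
    have : q z * t * polar q e w ∈ M.asIdeal := by
      rw [mul_assoc]; exact Ideal.mul_mem_right _ _ (hqz M)
    simpa using add_mem hc this
  obtain ⟨s, hs⟩ := (isUnit_of_forall_maximalSpectrum_notMem hwz').exists_right_inv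
  exact ⟨s, z', apply_sub_smul_eq_zero q (apply_sub_smul_eq_zero q he ht) hs⟩

end QuadraticForm

end Congruences

section BaseChange

variable {R S V : Type*} [CommRing R] [CommRing S] [Algebra R S] [AddCommGroup V] [Module R V]

namespace QuadraticForm

theorem IsNondegenerate.exists_polar_eq {q : QuadraticForm R V} (hq : q.IsNondegenerate)
    (f : Module.Dual R V) : ∃ y : V, ∀ v, polar q y v = f v := by
  obtain ⟨y, hy⟩ := hq.surjective f
  exact ⟨y, fun v ↦ DFunLike.congr_fun hy v⟩

/-- A vector orthogonal modulo `I` to the whole space vanishes modulo `I`. -/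
theorem IsQuadraticSpace.mem_smul_top_of_polar_mem {q : QuadraticForm R V}
    (hq : q.IsQuadraticSpace) {I : Ideal R} {v : V} (h : ∀ u, polar q v u ∈ I) :
    v ∈ I • (⊤ : Submodule R V) := by
  have := hq.free
  have := hq.finite
  let e := Module.Free.chooseBasis R V
  rw [← e.sum_repr v]
  refine Submodule.sum_mem _ fun i _ ↦ Submodule.smul_mem_smul ?_ trivial
  obtain ⟨y, hy⟩ := hq.nondegenerate.exists_polar_eq (e.coord i)
  rw [← Module.Basis.coord_apply, ← hy, QuadraticMap.polar_comm]
  exact h y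

variable [Invertible (2 : R)] (q : QuadraticForm R V)

theorem baseChange_apply_tmul (s : S) (v : V) :
    q.baseChange S (s ⊗ₜ v) = algebraMap R S (q v) * s ^ 2 := by
  rw [QuadraticForm.baseChange_tmul, Algebra.smul_def, sq]

theorem polar_baseChange_tmul (s t : S) (v u : V) :
    polar (q.baseChange S) (s ⊗ₜ v) (t ⊗ₜ u) = algebraMap R S (polar q v u) * (s * t) := by
  have h1 : polar (q.baseChange S) (1 ⊗ₜ[R] v) (1 ⊗ₜ[R] u) = algebraMap R S (polar q v u) := by
    simp only [polar, ← TensorProduct.tmul_add, baseChange_apply_tmul, map_sub]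
    ring
  have hs (s : S) (v : V) : s ⊗ₜ[R] v = s • (1 ⊗ₜ[R] v) := by
    rw [TensorProduct.smul_tmul', smul_eq_mul, mul_one]
  rw [hs s, hs t, QuadraticMap.polar_smul_left, QuadraticMap.polar_smul_right, h1, smul_eq_mul,
    smul_eq_mul]
  ring

variable {q} in
/-- Linear forms on the base change of a quadratic space are represented by vectors. -/
theorem IsQuadraticSpace.exists_polar_baseChange_eq (hq : q.IsQuadraticSpace)
    (f : Module.Dual S (S ⊗[R] V)) : ∃ y, ∀ v, polar (q.baseChange S) y v = f v := by
  have := hq.free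
  have := hq.finite
  let e := Module.Free.chooseBasis R V
  choose y hy using fun i ↦ hq.nondegenerate.exists_polar_eq (e.coord i)
  refine ⟨∑ i, f (1 ⊗ₜ e i) • (1 ⊗ₜ y i), fun v ↦ ?_⟩
  have : polarBilin (q.baseChange S) (∑ i, f (1 ⊗ₜ e i) • (1 ⊗ₜ y i)) = f := by
    classical
    refine (e.baseChange S).ext fun j ↦ ?_
    simp [LinearMap.sum_apply, polar_baseChange_tmul, hy, Finsupp.single_apply]
  exact DFunLike.congr_fun this v

end QuadraticForm

end BaseChange

section PowerBasis

variable {R S V : Type*} [CommRing R] [CommRing S] [Algebra R S] [AddCommGroup V] [Module R V]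

/-- The element `v₀ + x v₁ + x² v₂` of the base change of `V` to `S`. -/
def powTensor (R : Type*) {S V : Type*} [CommRing R] [CommRing S] [Algebra R S] [AddCommGroup V]
    [Module R V] (x : S) (v₀ v₁ v₂ : V) : S ⊗[R] V :=
  1 ⊗ₜ v₀ + x ⊗ₜ v₁ + (x ^ 2) ⊗ₜ v₂

theorem powTensor_add (x : S) (v₀ v₁ v₂ w₀ w₁ w₂ : V) :
    powTensor R x (v₀ + w₀) (v₁ + w₁) (v₂ + w₂) =
      powTensor R x v₀ v₁ v₂ + powTensor R x w₀ w₁ w₂ := by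
  simp only [powTensor, TensorProduct.tmul_add]
  abel

theorem powTensor_smul (x : S) (r : R) (v₀ v₁ v₂ : V) :
    powTensor R x (r • v₀) (r • v₁) (r • v₂) = r • powTensor R x v₀ v₁ v₂ := by
  simp only [powTensor, TensorProduct.tmul_smul, smul_add]

theorem powTensor_neg (x : S) (v₀ v₁ v₂ : V) :
    powTensor R x (-v₀) (-v₁) (-v₂) = -powTensor R x v₀ v₁ v₂ := by
  simp only [powTensor, TensorProduct.tmul_neg]
  abel

theorem QuadraticForm.baseChange_apply_powTensor [Invertible (2 : R)] (q : QuadraticForm R V)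
    (x : S) (v₀ v₁ v₂ : V) :
    q.baseChange S (powTensor R x v₀ v₁ v₂) =
      algebraMap R S (q v₀) + algebraMap R S (polar q v₀ v₁) * x +
        algebraMap R S (polar q v₀ v₂ + q v₁) * x ^ 2 + algebraMap R S (polar q v₁ v₂) * x ^ 3 +
        algebraMap R S (q v₂) * x ^ 4 := by
  simp only [powTensor, apply_add, QuadraticMap.polar_add_left, baseChange_apply_tmul,
    polar_baseChange_tmul, map_add]
  ring

theorem apply_tmul_mem_map {I : Ideal R} (f : Module.Dual S (S ⊗[R] V)) (s : S) {v : V}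
    (hv : v ∈ I • (⊤ : Submodule R V)) : f (s ⊗ₜ v) ∈ I.map (algebraMap R S) := by
  induction hv using Submodule.smul_induction_on' with
  | smul r hr n _ =>
    rw [TensorProduct.tmul_smul, ← algebraMap_smul S r, map_smul, smul_eq_mul]
    exact Ideal.mul_mem_right _ _ (Ideal.mem_map_of_mem _ hr)
  | add x _ y _ hx hy =>
    rw [TensorProduct.tmul_add, map_add]
    exact add_mem hx hy

theorem powTensor_eq_add_sub_smul (x : S) (c : R) (v₀ v₁ v₂ : V) :
    powTensor R x v₀ v₁ v₂ = 1 ⊗ₜ (v₀ + c • v₁ + c ^ 2 • v₂) +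
      (x - algebraMap R S c) • powTensor R x (v₁ + c • v₂) v₂ 0 := by
  have e1 (s : S) (u : V) : (algebraMap R S c * s) ⊗ₜ[R] u = s ⊗ₜ[R] (c • u) := by
    rw [← Algebra.smul_def, TensorProduct.smul_tmul]
  simp only [powTensor, TensorProduct.tmul_add, TensorProduct.tmul_zero, smul_add,
    TensorProduct.smul_tmul', smul_eq_mul, sub_mul, TensorProduct.sub_tmul, e1, smul_smul]
  simp only [mul_one, ← sq, TensorProduct.tmul_smul]
  module

theorem QuadraticForm.baseChange_apply_mem_of_tmul_add_smul [Invertible (2 : R)]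
    (q : QuadraticForm R V) {I : Ideal R} {h : V} (hq : q h ∈ I)
    (hh : h ∈ I • (⊤ : Submodule R V)) {s : S} {w : S ⊗[R] V}
    (hw : q.baseChange S (1 ⊗ₜ h + s • w) = 0) (f : Module.Dual S (S ⊗[R] V))
    (hf : f (1 ⊗ₜ h + s • w) = 1) : q.baseChange S w ∈ I.map (algebraMap R S) := by
  have hf' : 1 - s * f w ∈ I.map (algebraMap R S) := by
    have h0 := apply_tmul_mem_map f 1 hh
    rw [map_add, map_smul, smul_eq_mul] at hf
    rwa [← hf, add_sub_cancel_right]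
  have h1 : polar (q.baseChange S) w (1 ⊗ₜ h) ∈ I.map (algebraMap R S) :=
    apply_tmul_mem_map (polarBilin (q.baseChange S) w) 1 hh
  have h2 : algebraMap R S (q h) ∈ I.map (algebraMap R S) := Ideal.mem_map_of_mem _ hq
  rw [apply_add, QuadraticMap.map_smul, QuadraticMap.polar_smul_right,
    baseChange_apply_tmul, smul_eq_mul, smul_eq_mul, QuadraticMap.polar_comm] at hw
  generalize q.baseChange S w = a, polar (q.baseChange S) w (1 ⊗ₜ h) = p at *
  have : a = (1 + s * f w) * a * (1 - s * f w) +
      -(f w ^ 2 * (algebraMap R S (q h) + s * p)) := by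
    linear_combination f w ^ 2 * hw
  rw [this]
  exact add_mem (Ideal.mul_mem_left _ _ hf') (neg_mem (Ideal.mul_mem_left _ _
    (add_mem h2 (Ideal.mul_mem_left _ _ h1))))

variable {x : S} {b : Module.Basis (Fin 3) R S} (hb : ∀ i, b i = x ^ (i : ℕ))
include hb

theorem exists_eq_pow_combination (s : S) : ∃ a₀ a₁ a₂ : R,
    s = algebraMap R S a₀ + algebraMap R S a₁ * x + algebraMap R S a₂ * x ^ 2 := by
  refine ⟨b.repr s 0, b.repr s 1, b.repr s 2, ?_⟩
  conv_lhs => rw [← b.sum_repr s]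
  simp [Fin.sum_univ_three, hb, Algebra.smul_def]

theorem coeff_mem_of_pow_combination_mem_map {I : Ideal R} {a₀ a₁ a₂ : R}
    (h : algebraMap R S a₀ + algebraMap R S a₁ * x + algebraMap R S a₂ * x ^ 2 ∈
      I.map (algebraMap R S)) : a₀ ∈ I ∧ a₁ ∈ I ∧ a₂ ∈ I := by
  have h' : algebraMap R S a₀ + algebraMap R S a₁ * x + algebraMap R S a₂ * x ^ 2 ∈
      I • (⊤ : Submodule R S) := by
    rw [Ideal.smul_top_eq_map]; exact h
  have hs : algebraMap R S a₀ + algebraMap R S a₁ * x + algebraMap R S a₂ * x ^ 2 =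
      a₀ • b 0 + a₁ • b 1 + a₂ • b 2 := by
    simp [hb, Algebra.smul_def]
  rw [hs] at h'
  have H (i : Fin 3) := Module.Dual.apply_mem_of_mem_smul_top (b.coord i) h'
  have H0 := H 0
  have H1 := H 1
  have H2 := H 2
  simp at H0 H1 H2
  exact ⟨H0, H1, H2⟩

theorem coeff_eq_of_pow_combination_eq_zero {a₀ a₁ a₂ : R}
    (h : algebraMap R S a₀ + algebraMap R S a₁ * x + algebraMap R S a₂ * x ^ 2 = 0) :
    a₀ = 0 ∧ a₁ = 0 ∧ a₂ = 0 := by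
  simpa using coeff_mem_of_pow_combination_mem_map hb (I := ⊥) (by rw [h]; exact zero_mem _)

theorem exists_eq_powTensor (w : S ⊗[R] V) : ∃ v₀ v₁ v₂ : V, w = powTensor R x v₀ v₁ v₂ := by
  induction w with
  | zero => exact ⟨0, 0, 0, by simp [powTensor]⟩
  | tmul s v =>
    obtain ⟨a₀, a₁, a₂, rfl⟩ := exists_eq_pow_combination hb s
    refine ⟨a₀ • v, a₁ • v, a₂ • v, ?_⟩
    simp only [powTensor, TensorProduct.add_tmul, TensorProduct.tmul_smul,
      TensorProduct.smul_tmul', Algebra.algebraMap_eq_smul_one]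
    simp
  | add y z hy hz =>
    obtain ⟨v₀, v₁, v₂, rfl⟩ := hy
    obtain ⟨w₀, w₁, w₂, rfl⟩ := hz
    exact ⟨_, _, _, (powTensor_add ..).symm⟩

theorem exists_smul_eq_powTensor {I : Ideal R} {t : S} (ht : t ∈ I.map (algebraMap R S))
    (w : S ⊗[R] V) : ∃ v₀ ∈ I • (⊤ : Submodule R V), ∃ v₁ ∈ I • (⊤ : Submodule R V),
      ∃ v₂ ∈ I • (⊤ : Submodule R V), t • w = powTensor R x v₀ v₁ v₂ := by
  have ht' : t ∈ I • (⊤ : Submodule R S) := by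
    rw [Ideal.smul_top_eq_map]; exact ht
  clear ht
  induction ht' using Submodule.smul_induction_on' with
  | smul r hr s _ =>
    obtain ⟨v₀, v₁, v₂, h⟩ := exists_eq_powTensor hb (s • w)
    refine ⟨r • v₀, Submodule.smul_mem_smul hr trivial, r • v₁,
      Submodule.smul_mem_smul hr trivial, r • v₂, Submodule.smul_mem_smul hr trivial, ?_⟩
    rw [powTensor_smul, smul_assoc, h]
  | add s _ t _ hs ht =>
    obtain ⟨v₀, h₀, v₁, h₁, v₂, h₂, h⟩ := hs
    obtain ⟨w₀, h₀', w₁, h₁', w₂, h₂', h'⟩ := ht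
    exact ⟨_, add_mem h₀ h₀', _, add_mem h₁ h₁', _, add_mem h₂ h₂', by
      rw [powTensor_add, add_smul, h, h']⟩

section Isotropic

variable {c₀ c₁ c₂ : R}
  (hx : x ^ 3 = algebraMap R S c₀ + algebraMap R S c₁ * x + algebraMap R S c₂ * x ^ 2)
include hx

omit hb in
theorem pow_four_eq_of_pow_three_eq : x ^ 4 = algebraMap R S (c₀ * c₂) +
    algebraMap R S (c₀ + c₁ * c₂) * x + algebraMap R S (c₁ + c₂ ^ 2) * x ^ 2 := by
  simp only [map_add, map_mul, map_pow]
  linear_combination (x + algebraMap R S c₂) * hx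

variable [Invertible (2 : R)] {q : QuadraticForm R V} {v₀ v₁ v₂ : V}
  (hv : q.baseChange S (powTensor R x v₀ v₁ v₂) = 0)
include hv

namespace QuadraticForm

/-- The quartic polynomial `q (v₀ + t v₁ + t² v₂)` is divisible by the minimal polynomial of `x`
if it vanishes at `x`. -/
theorem coeff_eq_of_baseChange_powTensor_eq_zero :
    q v₀ + c₀ * polar q v₁ v₂ + c₀ * c₂ * q v₂ = 0 ∧
    polar q v₀ v₁ + c₁ * polar q v₁ v₂ + (c₀ + c₁ * c₂) * q v₂ = 0 ∧
    polar q v₀ v₂ + q v₁ + c₂ * polar q v₁ v₂ + (c₁ + c₂ ^ 2) * q v₂ = 0 := by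
  refine coeff_eq_of_pow_combination_eq_zero hb (x := x) ?_
  rw [baseChange_apply_powTensor, hx, pow_four_eq_of_pow_three_eq hx] at hv
  rw [← hv]
  simp only [map_add, map_mul, map_pow]
  ring

/-- Evaluation of the quartic polynomial `q (v₀ + t v₁ + t² v₂)`, which vanishes at `x`. -/
theorem apply_add_smul_add_smul_eq (c : R) :
    q (v₀ + c • v₁ + c ^ 2 • v₂) =
      (c ^ 3 - c₂ * c ^ 2 - c₁ * c - c₀) * (q v₂ * c + polar q v₁ v₂ + c₂ * q v₂) := by
  obtain ⟨h₀, h₁, h₂⟩ := coeff_eq_of_baseChange_powTensor_eq_zero hb hx hv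
  simp only [apply_add, QuadraticMap.map_smul, QuadraticMap.polar_add_left,
    QuadraticMap.polar_smul_left, QuadraticMap.polar_smul_right, smul_eq_mul]
  linear_combination h₀ + c * h₁ + c ^ 2 * h₂

theorem exists_apply_add_smul_add_smul_eq_zero (h : IsUnit (q v₂)) :
    ∃ c : R, q (v₀ + c • v₁ + c ^ 2 • v₂) = 0 := by
  obtain ⟨a, ha⟩ := h.exists_right_inv
  refine ⟨-a * (polar q v₁ v₂ + c₂ * q v₂), ?_⟩
  rw [apply_add_smul_add_smul_eq hb hx hv]
  convert! mul_zero _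
  linear_combination -(polar q v₁ v₂ + c₂ * q v₂) * ha

/-- Springer's theorem in degree three over a residue field. -/
theorem exists_mem_notMem_smul_top {m : Ideal R} [m.IsMaximal]
    (f : Module.Dual S (S ⊗[R] V)) (hf : f (powTensor R x v₀ v₁ v₂) = 1) :
    ∃ h : V, q h ∈ m ∧ h ∉ m • (⊤ : Submodule R V) := by
  by_contra! H
  obtain ⟨h₀, h₁, h₂⟩ := coeff_eq_of_baseChange_powTensor_eq_zero hb hx hv
  by_cases hm : q v₂ ∈ m
  · have hv₂ := H _ hm
    have hp (u : V) : polar q u v₂ ∈ m := polar_mem_of_mem_smul_top_right q u hv₂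
    have hv₁ := H v₁ <| by
      have : q v₁ = -(polar q v₀ v₂ + c₂ * polar q v₁ v₂ + (c₁ + c₂ ^ 2) * q v₂) := by
        linear_combination h₂
      rw [this]
      exact neg_mem (add_mem (add_mem (hp _) (m.mul_mem_left _ (hp _))) (m.mul_mem_left _ hm))
    have hv₀ := H v₀ <| by
      have : q v₀ = -(c₀ * polar q v₁ v₂ + c₀ * c₂ * q v₂) := by linear_combination h₀
      rw [this]
      exact neg_mem (add_mem (m.mul_mem_left _ (hp _)) (m.mul_mem_left _ hm))
    have h1 : algebraMap R S 1 + algebraMap R S 0 * x + algebraMap R S 0 * x ^ 2 ∈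
        m.map (algebraMap R S) := by
      rw [map_one, map_zero, zero_mul, zero_mul, add_zero, add_zero, ← hf, powTensor, map_add,
        map_add]
      exact add_mem (add_mem (apply_tmul_mem_map f _ hv₀) (apply_tmul_mem_map f _ hv₁))
        (apply_tmul_mem_map f _ hv₂)
    exact (Ideal.ne_top_iff_one m).mp Ideal.IsPrime.ne_top'
      (coeff_mem_of_pow_combination_mem_map hb h1).1
  · obtain ⟨a, ha⟩ : ∃ a, a * q v₂ - 1 ∈ m := by
      obtain ⟨a, ha⟩ := Ideal.IsMaximal.exists_inv ‹_› hm
      obtain ⟨i, hi, h⟩ := ha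
      exact ⟨a, by rw [← h]; simpa using hi⟩
    obtain ⟨c, hc⟩ : ∃ c, q (v₀ + c • v₁ + c ^ 2 • v₂) ∈ m := by
      refine ⟨-a * (polar q v₁ v₂ + c₂ * q v₂), ?_⟩
      rw [apply_add_smul_add_smul_eq hb hx hv]
      refine m.mul_mem_left _ ?_
      convert! m.mul_mem_left (-(polar q v₁ v₂ + c₂ * q v₂)) ha using 1
      ring
    have hh := H _ hc
    refine hm (coeff_mem_of_pow_combination_mem_map hb (I := m) (x := x)
      (a₀ := q (v₁ + c • v₂)) (a₁ := polar q (v₁ + c • v₂) v₂) (a₂ := q v₂) ?_).2.2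
    rw [powTensor_eq_add_sub_smul x c] at hv hf
    have := baseChange_apply_mem_of_tmul_add_smul (I := m) q hc hh hv f hf
    rw [baseChange_apply_powTensor] at this
    simpa using this

end QuadraticForm

end Isotropic

end PowerBasis

section RankAtLeastThree

namespace QuadraticForm

variable {R S V : Type*} [CommRing R] [CommRing S] [Algebra R S] [AddCommGroup V] [Module R V]
  [Invertible (2 : R)] {q : QuadraticForm R V}

omit [Invertible (2 : R)] in
/-- A quadratic space of rank at least `3` which is isotropic modulo a maximal ideal contains,
modulo this ideal, a hyperbolic pair together with an orthogonal anisotropic vector. -/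
theorem IsQuadraticSpace.exists_hyperbolic_pair_mod (hq : q.IsQuadraticSpace)
    (hrk : 3 ≤ Module.finrank R V) (m : Ideal R) [m.IsMaximal] {h : V} (hh : q h ∈ m)
    (hhm : h ∉ m • (⊤ : Submodule R V)) :
    ∃ g d : V, q g ∈ m ∧ polar q h g - 1 ∈ m ∧ polar q d h ∈ m ∧ polar q d g ∈ m ∧ q d ∉ m := by
  have := hq.free
  have := hq.finite
  have : Nontrivial R := ⟨0, 1, fun h01 ↦ (Ideal.ne_top_iff_one m).mp Ideal.IsPrime.ne_top'
    (h01 ▸ zero_mem m)⟩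
  have hself (v : V) : polar q v v = 2 * q v := by simp [two_mul, two_smul]
  obtain ⟨y, hy⟩ : ∃ y, polar q h y ∉ m := by
    by_contra! H
    exact hhm (hq.mem_smul_top_of_polar_mem H)
  obtain ⟨a, i, hi, ha⟩ := Ideal.IsMaximal.exists_inv ‹_› hy
  obtain ⟨g, hg, hhg⟩ : ∃ g, q g ∈ m ∧ polar q h g - 1 ∈ m := by
    refine ⟨a • y + (-q (a • y)) • h, ?_, ?_⟩
    · rw [apply_add, QuadraticMap.map_smul q (-q (a • y)), QuadraticMap.polar_smul_right,
        QuadraticMap.polar_smul_left, QuadraticMap.polar_comm q y h, smul_eq_mul, smul_eq_mul,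
        smul_eq_mul]
      convert! add_mem (m.mul_mem_left (q (a • y)) hi) (m.mul_mem_left (q (a • y) ^ 2) hh) using 1
      linear_combination -q (a • y) * ha
    · rw [QuadraticMap.polar_add_right, QuadraticMap.polar_smul_right,
        QuadraticMap.polar_smul_right, hself, smul_eq_mul, smul_eq_mul]
      convert! add_mem (neg_mem hi) (m.mul_mem_left (-2 * q (a • y)) hh) using 1
      linear_combination ha
  let p (d : V) : V := d + (-polar q d g) • h + (-polar q d h) • g
  have hph (d : V) : polar q (p d) h ∈ m := by
    simp only [p, QuadraticMap.polar_add_left, QuadraticMap.polar_smul_left, hself, smul_eq_mul,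
      QuadraticMap.polar_comm q g h]
    convert! add_mem (m.mul_mem_left (-2 * polar q d g) hh) (m.mul_mem_left (-polar q d h) hhg)
      using 1
    ring
  have hpg (d : V) : polar q (p d) g ∈ m := by
    simp only [p, QuadraticMap.polar_add_left, QuadraticMap.polar_smul_left, hself, smul_eq_mul]
    convert! add_mem (m.mul_mem_left (-2 * polar q d h) hg) (m.mul_mem_left (-polar q d g) hhg)
      using 1
    ring
  obtain ⟨d, hd⟩ : ∃ d, q (p d) ∉ m := by
    by_contra! H
    have hpp (d d' : V) : polar q (p d) (p d') ∈ m := by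
      have h1 : p d + p d' = p (d + d') := by
        simp only [p, QuadraticMap.polar_add_left]
        module
      rw [polar, h1]
      exact sub_mem (sub_mem (H _) (H _)) (H _)
    have hmem (d : V) : p d ∈ m • (⊤ : Submodule R V) := by
      refine hq.mem_smul_top_of_polar_mem fun u ↦ ?_
      have hu : u = p u + (polar q u g) • h + (polar q u h) • g := by
        simp only [p]
        module
      rw [hu, QuadraticMap.polar_add_right, QuadraticMap.polar_add_right,
        QuadraticMap.polar_smul_right, QuadraticMap.polar_smul_right]
      exact add_mem (add_mem (hpp _ _) (m.mul_mem_left _ (hph _))) (m.mul_mem_left _ (hpg _))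
    let e := Module.finBasis R V
    let A : Matrix (Fin (Module.finrank R V)) (Fin 2) (R ⧸ m) := fun i j ↦
      Ideal.Quotient.mk m (![polar q (e i) g, polar q (e i) h] j)
    let B : Matrix (Fin 2) (Fin (Module.finrank R V)) (R ⧸ m) := fun j k ↦
      Ideal.Quotient.mk m (![e.coord k h, e.coord k g] j)
    have hAB : A * B = 1 := by
      ext i k
      have := Module.Dual.apply_mem_of_mem_smul_top (e.coord k) (hmem (e i))
      simp only [p, map_add, map_smul, smul_eq_mul, Module.Basis.coord_apply,
        Module.Basis.repr_self] at this
      rw [← Ideal.Quotient.eq_zero_iff_mem] at this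
      simp only [map_add, map_mul, map_neg] at this
      have h1 : (1 : Matrix _ _ (R ⧸ m)) i k =
          Ideal.Quotient.mk m ((Finsupp.single i (1 : R)) k) := by
        by_cases hik : i = k <;> simp [Matrix.one_apply, hik]
      rw [h1, Matrix.mul_apply, Fin.sum_univ_two]
      simp only [A, B, Module.Basis.coord_apply, Matrix.cons_val_zero, Matrix.cons_val_one]
      linear_combination -this
    let := Ideal.Quotient.field m
    have h1 := Matrix.rank_mul_le_left A B
    rw [hAB, Matrix.rank_one, Fintype.card_fin] at h1
    have h2 := A.rank_le_width
    omega
  exact ⟨g, p d, hg, hhg, hph d, hpg d, hd⟩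

omit [Invertible (2 : R)] in
theorem isUnimodularVector_of_isUnit_polar {v u : V} (h : IsUnit (polar q v u)) :
    IsUnimodularVector R v := by
  obtain ⟨a, ha⟩ := h.exists_right_inv
  refine ⟨a • polarBilin q u, ?_⟩
  rw [LinearMap.smul_apply, QuadraticMap.polarBilin_apply_apply, QuadraticMap.polar_comm,
    smul_eq_mul, mul_comm, ha]

/-- Descent of isotropy along a cubic algebra with a power basis, in rank at least `3`. -/
theorem IsQuadraticSpace.isIsotropic_of_baseChange (hq : q.IsQuadraticSpace)
    (hrk : 3 ≤ Module.finrank R V) [Finite (MaximalSpectrum R)] [Finite (MaximalSpectrum S)]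
    [Module.Finite R S] {x : S} {b : Module.Basis (Fin 3) R S} (hb : ∀ i, b i = x ^ (i : ℕ))
    (hS : (q.baseChange S).IsIsotropic) : q.IsIsotropic := by
  obtain ⟨e, ⟨f, hf⟩, he⟩ := hS
  obtain ⟨c₀, c₁, c₂, hx⟩ := exists_eq_pow_combination hb (x ^ 3)
  have hx4 := pow_four_eq_of_pow_three_eq hx
  obtain ⟨y, hy⟩ := hq.exists_polar_baseChange_eq f
  have hey : polar (q.baseChange S) e y = 1 := by rw [QuadraticMap.polar_comm, hy, hf]
  have hloc (m : MaximalSpectrum R) : ∃ h g d : V, q h ∈ m.asIdeal ∧ q g ∈ m.asIdeal ∧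
      polar q h g - 1 ∈ m.asIdeal ∧ polar q d h ∈ m.asIdeal ∧ polar q d g ∈ m.asIdeal ∧
      q d ∉ m.asIdeal := by
    obtain ⟨v₀, v₁, v₂, rfl⟩ := exists_eq_powTensor hb e
    obtain ⟨h, hh, hhm⟩ := exists_mem_notMem_smul_top hb hx he (m := m.asIdeal) f hf
    obtain ⟨g, d, H⟩ := hq.exists_hyperbolic_pair_mod hrk m.asIdeal hh hhm
    exact ⟨h, g, d, hh, H⟩
  choose h' g' d' hh' hg' hhg' hdh' hdg' hd' using hloc
  obtain ⟨h, hh⟩ := exists_forall_sub_mem_smul_top h'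
  obtain ⟨g, hg⟩ := exists_forall_sub_mem_smul_top g'
  obtain ⟨d, hd⟩ := exists_forall_sub_mem_smul_top d'
  let J : Ideal R := ⨅ m : MaximalSpectrum R, m.asIdeal
  have hJm (m : MaximalSpectrum R) : J ≤ m.asIdeal := iInf_le _ m
  have Hh : q h ∈ J := Ideal.mem_iInf.mpr fun m ↦ by
    simpa using add_mem (apply_sub_apply_mem q (hh m)) (hh' m)
  have Hg : q g ∈ J := Ideal.mem_iInf.mpr fun m ↦ by
    simpa using add_mem (apply_sub_apply_mem q (hg m)) (hg' m)
  have Hhg : polar q h g - 1 ∈ J := Ideal.mem_iInf.mpr fun m ↦ by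
    simpa using add_mem (polar_sub_polar_mem q (hh m) (hg m)) (hhg' m)
  have Hdh : polar q d h ∈ J := Ideal.mem_iInf.mpr fun m ↦ by
    simpa using add_mem (polar_sub_polar_mem q (hd m) (hh m)) (hdh' m)
  have Hdg : polar q d g ∈ J := Ideal.mem_iInf.mpr fun m ↦ by
    simpa using add_mem (polar_sub_polar_mem q (hd m) (hg m)) (hdg' m)
  have Hd (m : MaximalSpectrum R) : q d ∉ m.asIdeal := fun hc ↦ hd' m <| by
    simpa using sub_mem hc (apply_sub_apply_mem q (hd m))
  have unit_of_sub_mem {r s : R} (hs : ∀ m : MaximalSpectrum R, s ∉ m.asIdeal)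
      (hrs : r - s ∈ J) : IsUnit r := isUnit_of_forall_maximalSpectrum_notMem fun m hc ↦ hs m <| by
    simpa using sub_mem hc (hJm m hrs)
  have hgg : polar q g g ∈ J := by
    have := J.mul_mem_left 2 Hg
    simpa [two_mul, two_smul] using this
  have hdd : polar q d d = 2 * q d := by simp [two_mul, two_smul]
  have hmap {r : R} (hr : r ∈ J) :
      Ideal.Quotient.mk (J.map (algebraMap R S)) (algebraMap R S r) = 0 :=
    Ideal.Quotient.eq_zero_iff_mem.mpr (Ideal.mem_map_of_mem _ hr)
  have hhg1 : Ideal.Quotient.mk (J.map (algebraMap R S)) (algebraMap R S (polar q h g)) = 1 := by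
    have := hmap Hhg
    rwa [map_sub, map_sub, sub_eq_zero, map_one, map_one] at this
  have hcomap (M : MaximalSpectrum S) : (M.asIdeal.comap (algebraMap R S)).IsMaximal :=
    Ideal.isMaximal_comap_of_isIntegral_of_isMaximal M.asIdeal
  have hJM (M : MaximalSpectrum S) : J.map (algebraMap R S) ≤ M.asIdeal :=
    Ideal.map_le_iff_le_comap.mpr (hJm ⟨_, hcomap M⟩)
  let s : S := -(algebraMap R S (q d) * x ^ 4)
  let r : S := -(2 * x ^ 2 * algebraMap R S (q d))
  let w : S ⊗[R] V := 1 ⊗ₜ h + s ⊗ₜ g + (x ^ 2) ⊗ₜ d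
  let u : S ⊗[R] V := 1 ⊗ₜ d + r ⊗ₜ g
  have hw : q.baseChange S w ∈ J.map (algebraMap R S) := by
    rw [← Ideal.Quotient.eq_zero_iff_mem]
    simp only [w, s, apply_add, QuadraticMap.polar_add_left, baseChange_apply_tmul,
      polar_baseChange_tmul, map_add, map_mul, map_neg, hmap Hh, hmap Hg, hhg1,
      QuadraticMap.polar_comm q h d, QuadraticMap.polar_comm q g d, hmap Hdh, hmap Hdg, map_pow,
      map_one]
    ring
  have hwg : polar (q.baseChange S) w (1 ⊗ₜ g) - 1 ∈ J.map (algebraMap R S) := by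
    rw [← Ideal.Quotient.eq_zero_iff_mem]
    simp only [w, QuadraticMap.polar_add_left, polar_baseChange_tmul, map_add, map_mul, map_sub,
      hmap hgg, hhg1, hmap Hdg, map_one]
    ring
  have huw : polar (q.baseChange S) u w ∈ J.map (algebraMap R S) := by
    rw [← Ideal.Quotient.eq_zero_iff_mem]
    simp only [w, u, r, QuadraticMap.polar_add_left, QuadraticMap.polar_add_right,
      polar_baseChange_tmul, map_add, map_mul, map_neg, hmap hgg, hdd, hhg1,
      QuadraticMap.polar_comm q g h, QuadraticMap.polar_comm q g d, hmap Hdh, hmap Hdg, map_pow,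
      map_one, map_ofNat]
    ring
  have hug : polar (q.baseChange S) u (1 ⊗ₜ g) ∈ J.map (algebraMap R S) := by
    rw [← Ideal.Quotient.eq_zero_iff_mem]
    simp only [u, QuadraticMap.polar_add_left, polar_baseChange_tmul, map_add, map_mul,
      hmap hgg, hmap Hdg]
    ring
  have hu : q.baseChange S u - algebraMap R S (q d) ∈ J.map (algebraMap R S) := by
    rw [← Ideal.Quotient.eq_zero_iff_mem]
    simp only [u, apply_add, baseChange_apply_tmul, polar_baseChange_tmul, map_add, map_sub,
      map_mul, hmap Hg, hmap Hdg, map_pow, map_one]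
    ring
  have hu' (M : MaximalSpectrum S) : q.baseChange S u ∉ M.asIdeal := fun hc ↦
    Hd ⟨_, hcomap M⟩ <| by
      simpa using sub_mem hc (hJM M hu)
  have hgS : q.baseChange S (1 ⊗ₜ g) ∈ J.map (algebraMap R S) := by
    rw [baseChange_apply_tmul, one_pow, mul_one]
    exact Ideal.mem_map_of_mem _ Hg
  have : Invertible (2 : S) := (Invertible.map (algebraMap R S) 2).copy 2 (map_ofNat _ _).symm
  obtain ⟨t, z, hz⟩ := exists_apply_sub_smul_eq_zero (q.baseChange S) he hey (fun M ↦ hJM M hw)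
    (fun M ↦ hJM M hgS) (fun M ↦ hJM M hwg) (fun M ↦ hJM M huw) (fun M ↦ hJM M hug) hu'
  obtain ⟨j₀, hj₀, j₁, hj₁, j₂, hj₂, hj⟩ := exists_smul_eq_powTensor hb
    (Ideal.mul_mem_right t _ hw) z
  have hwp : w = powTensor R x (h + (-(q d * (c₀ * c₂))) • g)
      ((-(q d * (c₀ + c₁ * c₂))) • g) (d + (-(q d * (c₁ + c₂ ^ 2))) • g) := by
    simp only [w, s, hx4, powTensor, TensorProduct.tmul_add, TensorProduct.tmul_smul,
      TensorProduct.smul_tmul', Algebra.smul_def, mul_add, TensorProduct.add_tmul, neg_add, map_neg,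
      map_mul, map_add, map_pow, add_mul, mul_one, neg_mul, TensorProduct.neg_tmul, mul_assoc]
    abel
  rw [hj, hwp, sub_eq_add_neg, ← powTensor_neg, ← powTensor_add] at hz
  have hneg {j : V} (hj : j ∈ J • (⊤ : Submodule R V)) (v : V) : (v + -j) - v ∈
      J • (⊤ : Submodule R V) := by
    simpa using hj
  have hunit : IsUnit (q (d + (-(q d * (c₁ + c₂ ^ 2))) • g + -j₂)) := by
    refine unit_of_sub_mem Hd ?_
    have h1 := apply_sub_apply_mem q (hneg hj₂ (d + (-(q d * (c₁ + c₂ ^ 2))) • g))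
    rw [apply_add q d, QuadraticMap.map_smul, QuadraticMap.polar_smul_right, smul_eq_mul,
      smul_eq_mul] at h1
    have := add_mem h1 (add_mem (J.mul_mem_left ((-(q d * (c₁ + c₂ ^ 2))) ^ 2) Hg)
      (J.mul_mem_left (-(q d * (c₁ + c₂ ^ 2))) Hdg))
    convert! this using 1
    ring
  obtain ⟨c, hc⟩ := exists_apply_add_smul_add_smul_eq_zero hb hx hz hunit
  refine ⟨_, isUnimodularVector_of_isUnit_polar (q := q) (u := g) (unit_of_sub_mem (s := 1)
    (fun m ↦ (Ideal.ne_top_iff_one _).mp m.isMaximal.ne_top) ?_), hc⟩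
  rw [← Ideal.Quotient.eq_zero_iff_mem]
  have h1 : Ideal.Quotient.mk J (polar q h g) = 1 := by
    have := Ideal.Quotient.eq_zero_iff_mem.mpr Hhg
    rwa [map_sub, sub_eq_zero, map_one] at this
  have hjg {j : V} (hj : j ∈ J • (⊤ : Submodule R V)) : Ideal.Quotient.mk J (polar q j g) = 0 :=
    Ideal.Quotient.eq_zero_iff_mem.mpr (polar_mem_of_mem_smul_top_left q g hj)
  simp only [QuadraticMap.polar_add_left, QuadraticMap.polar_smul_left, QuadraticMap.polar_neg_left,
    smul_eq_mul, map_add, map_sub, map_mul, map_neg, hjg hj₀, hjg hj₁, hjg hj₂, h1,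
    Ideal.Quotient.eq_zero_iff_mem.mpr hgg, Ideal.Quotient.eq_zero_iff_mem.mpr Hdg, map_one]
  ring

end QuadraticForm

end RankAtLeastThree

section RankAtMostTwo

namespace QuadraticForm

variable {R S V : Type*} [CommRing R] [CommRing S] [Algebra R S] [AddCommGroup V] [Module R V]

theorem IsQuadraticSpace.isUnit_discr_of_basis {q : QuadraticForm R V} (hq : q.IsQuadraticSpace)
    (e : Module.Basis (Fin 2) R V) :
    IsUnit (polar q (e 0) (e 1) ^ 2 - 4 * q (e 0) * q (e 1)) := by
  have hself (v : V) : polar q v v = 2 * q v := by simp [two_mul, two_smul]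
  have key (i : Fin 2) : ∃ a b : R, ∀ j,
      a * polar q (e 0) (e j) + b * polar q (e 1) (e j) = e.coord i (e j) := by
    obtain ⟨y, hy⟩ := hq.nondegenerate.exists_polar_eq (e.coord i)
    refine ⟨e.repr y 0, e.repr y 1, fun j ↦ ?_⟩
    rw [← hy]
    conv_rhs => rw [← e.sum_repr y, Fin.sum_univ_two]
    rw [QuadraticMap.polar_add_left, QuadraticMap.polar_smul_left, QuadraticMap.polar_smul_left,
      smul_eq_mul, smul_eq_mul]
  obtain ⟨a, b, h⟩ := key 0
  obtain ⟨c, d, h'⟩ := key 1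
  have h0 := h 0
  have h1 := h 1
  have h0' := h' 0
  have h1' := h' 1
  simp only [hself, QuadraticMap.polar_comm q (e 1) (e 0), Module.Basis.coord_apply,
    Module.Basis.repr_self, Finsupp.single_apply] at h0 h1 h0' h1'
  simp at h0 h1 h0' h1'
  refine IsUnit.of_mul_eq_one (-(a * d - b * c)) ?_
  linear_combination h0 * (c * polar q (e 0) (e 1) + d * (2 * q (e 1))) + h1' -
    h1 * (c * (2 * q (e 0)) + d * polar q (e 0) (e 1))

/-- A binary quadratic form whose discriminant is an invertible square is isotropic over a
semi-local ring. -/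
theorem isIsotropic_of_discr_eq_sq [Invertible (2 : R)] [Finite (MaximalSpectrum R)]
    (q : QuadraticForm R V) (e : Module.Basis (Fin 2) R V) {δ : R} (hδ : IsUnit δ)
    (h : polar q (e 0) (e 1) ^ 2 - 4 * q (e 0) * q (e 1) = δ ^ 2) : q.IsIsotropic := by
  classical
  set β := polar q (e 0) (e 1) with hβ
  have happ (a b : R) :
      q (a • e 0 + b • e 1) = a ^ 2 * q (e 0) + b ^ 2 * q (e 1) + a * b * β := by
    simp only [apply_add, QuadraticMap.map_smul, QuadraticMap.polar_smul_left,
      QuadraticMap.polar_smul_right, smul_eq_mul, hβ]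
    ring
  obtain ⟨ε, hε⟩ := Ideal.exists_forall_sub_mem_ideal (I := fun m : MaximalSpectrum R ↦ m.asIdeal)
    (fun _ _ ne ↦ Ideal.isCoprime_of_isMaximal (MaximalSpectrum.ext_iff.ne.mp ne))
    (fun m ↦ if δ - β ∈ m.asIdeal ∧ 2 * q (e 0) ∈ m.asIdeal then (0 : R) else 1)
  let a := ε * (δ - β) + (1 - ε) * (2 * q (e 1))
  let b := ε * (2 * q (e 0)) + (1 - ε) * (-β - δ)
  have hspan : Ideal.span {a, b} = ⊤ := by
    by_contra hne
    obtain ⟨m, hm, hle⟩ := Ideal.exists_le_maximal _ hne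
    have ha : a ∈ m := hle (Ideal.subset_span (by simp))
    have hb : b ∈ m := hle (Ideal.subset_span (by simp))
    have hεm := hε ⟨m, hm⟩
    by_cases hc : δ - β ∈ m ∧ 2 * q (e 0) ∈ m
    · simp only [hc, and_self, if_true, sub_zero] at hεm
      have h1 : 2 * δ ∈ m := by
        convert! sub_mem (add_mem hc.1 (m.mul_mem_right (2 * q (e 0) + β + δ) hεm)) hb using 1
        simp only [b]
        ring
      have h2 : IsUnit (2 * δ) := (isUnit_of_invertible 2).mul hδ
      exact hm.ne_top (Ideal.eq_top_of_isUnit_mem m h1 h2)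
    · simp only [hc, if_false] at hεm
      refine hc ⟨?_, ?_⟩
      · convert! sub_mem ha (m.mul_mem_right (δ - β - 2 * q (e 1)) hεm) using 1
        simp only [a]
        ring
      · convert! sub_mem hb (m.mul_mem_right (2 * q (e 0) + β + δ) hεm) using 1
        simp only [b]
        ring
  obtain ⟨s, t, hst⟩ := Ideal.mem_span_pair.mp ((Ideal.eq_top_iff_one _).mp hspan)
  refine ⟨a • e 0 + b • e 1, ⟨s • e.coord 0 + t • e.coord 1, ?_⟩, ?_⟩
  · simpa using hst
  · rw [happ]
    simp only [a, b]
    linear_combination (-(q (e 0) * ε ^ 2) - q (e 1) * (1 - ε) ^ 2 + β * ε * (1 - ε)) * h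

variable [Invertible (2 : R)] {q : QuadraticForm R V}

/-- Descent of isotropy along a cubic algebra, in rank at most `2`. -/
theorem IsQuadraticSpace.isIsotropic_of_baseChange_of_finrank_lt (hq : q.IsQuadraticSpace)
    (hrk : Module.finrank R V < 3) [Nontrivial R] [Finite (MaximalSpectrum R)]
    (b : Module.Basis (Fin 3) R S) (hS : (q.baseChange S).IsIsotropic) : q.IsIsotropic := by
  have := hq.free
  have := hq.finite
  have hinj : Function.Injective (algebraMap R S) := by
    refine (injective_iff_map_eq_zero _).mpr fun r hr ↦ ?_
    have h : r • b 0 = 0 := by rw [Algebra.smul_def, hr, zero_mul]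
    simpa using congrArg (b.coord 0) h
  obtain ⟨w, ⟨f, hf⟩, hw⟩ := hS
  have hfs (s : S) (v : V) : f (s ⊗ₜ v) = s * f (1 ⊗ₜ v) := by
    rw [← smul_eq_mul, ← map_smul, TensorProduct.smul_tmul', smul_eq_mul, mul_one]
  generalize hn : Module.finrank R V = n at hrk
  let e := Module.finBasisOfFinrankEq R V hn
  have hsum := (e.baseChange S).sum_repr w
  generalize (e.baseChange S).repr w = c at hsum
  subst hsum
  simp only [Module.Basis.baseChange_apply, TensorProduct.smul_tmul', smul_eq_mul, mul_one]
    at hf hw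
  interval_cases n
  · simp only [Finset.univ_eq_empty, Finset.sum_empty, map_zero] at hf
    exact absurd (hinj (by simpa using hf)) zero_ne_one
  · simp only [Finset.univ_unique, Fin.default_eq_zero, Finset.sum_singleton,
      baseChange_apply_tmul] at hf hw
    refine ⟨e 0, ⟨e.coord 0, by simp⟩, hinj ?_⟩
    rw [hfs] at hf
    rw [map_zero (algebraMap R S)]
    linear_combination f (1 ⊗ₜ e 0) ^ 2 * hw -
      algebraMap R S (q (e 0)) * (c 0 * f (1 ⊗ₜ e 0) + 1) * hf
  · simp only [Fin.sum_univ_two, apply_add, baseChange_apply_tmul, polar_baseChange_tmul,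
      map_add] at hf hw
    rw [hfs (c 0), hfs (c 1)] at hf
    have hD := hq.isUnit_discr_of_basis e
    set D := polar q (e 0) (e 1) ^ 2 - 4 * q (e 0) * q (e 1) with hDdef
    obtain ⟨β, hβ⟩ : ∃ β : S, algebraMap R S D = β ^ 2 := by
      refine ⟨-(2 * c 0 * f (1 ⊗ₜ e 1) * algebraMap R S (q (e 0))) +
        (c 0 * f (1 ⊗ₜ e 0) - c 1 * f (1 ⊗ₜ e 1)) * algebraMap R S (polar q (e 0) (e 1)) +
        2 * c 1 * f (1 ⊗ₜ e 0) * algebraMap R S (q (e 1)), ?_⟩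
      simp only [hDdef, map_sub, map_mul, map_pow, map_ofNat]
      generalize f (1 ⊗ₜ e 0) = f₀, f (1 ⊗ₜ e 1) = f₁, algebraMap R S (q (e 0)) = α,
        algebraMap R S (q (e 1)) = γ, algebraMap R S (polar q (e 0) (e 1)) = η at *
      linear_combination -(η ^ 2 - 4 * α * γ) * (c 0 * f₀ + c 1 * f₁ + 1) * hf -
        4 * (f₁ ^ 2 * α - f₀ * f₁ * η + f₀ ^ 2 * γ) * hw
    obtain ⟨a, ha⟩ := hD.exists_right_inv
    have hN : D ^ 3 = Algebra.norm R β ^ 2 := by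
      rw [← map_pow, ← hβ, Algebra.norm_algebraMap_of_basis b, Fintype.card_fin]
    have hδ : D = (Algebra.norm R β * a) ^ 2 := by
      linear_combination a ^ 2 * hN - D * (D * a + 1) * ha
    refine isIsotropic_of_discr_eq_sq q e (δ := Algebra.norm R β * a) ?_ hδ
    exact isUnit_pow_iff two_ne_zero |>.mp (hδ ▸ hD)

end QuadraticForm

end RankAtMostTwo

theorem Module.Finite.finite_maximalSpectrum (R S : Type*) [CommRing R] [CommRing S] [Algebra R S]
    [Module.Finite R S] [Finite (MaximalSpectrum R)] : Finite (MaximalSpectrum S) := by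
  have h := Algebra.QuasiFinite.finite_comap_preimage (R := R) (S := S)
    (Set.finite_range (MaximalSpectrum.toPrimeSpectrum (R := R)))
  have hmem (M : MaximalSpectrum S) : M.toPrimeSpectrum ∈ PrimeSpectrum.comap (algebraMap R S) ⁻¹'
      Set.range (MaximalSpectrum.toPrimeSpectrum (R := R)) :=
    ⟨⟨_, Ideal.isMaximal_comap_of_isIntegral_of_isMaximal (R := R) M.asIdeal⟩, rfl⟩
  refine Set.finite_univ_iff.mp (Set.Finite.of_finite_image (h.subset ?_)
    (MaximalSpectrum.toPrimeSpectrum_injective (R := S)).injOn)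
  rintro _ ⟨M, -, rfl⟩
  exact hmem M

theorem proposition4p4 {R S V : Type*} [CommRing R] [Invertible (2 : R)]
    (hR : IsSemiLocalRing R)
    [CommRing S] [Algebra R S] (hS : IsFiniteEtaleOfDegree R S 3)
    [AddCommGroup V] [Module R V] (q : QuadraticForm R V) (hq : q.IsQuadraticSpace)
    (hani : q.IsStrictlyAnisotropic) :
    (QuadraticForm.baseChange S q).IsStrictlyAnisotropic := by
  intro hiso
  have : Finite (MaximalSpectrum R) := hR
  have := hS.finite
  have := Module.Finite.finite_maximalSpectrum R S
  have : Nontrivial R := by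
    by_contra h
    rw [not_nontrivial_iff_subsingleton] at h
    exact hani ⟨0, ⟨0, Subsingleton.elim _ _⟩, Subsingleton.elim _ _⟩
  obtain ⟨x, b, hb⟩ := hS.exists_basis_pow hR
  rcases lt_or_ge (Module.finrank R V) 3 with hrk | hrk
  · exact hani (hq.isIsotropic_of_baseChange_of_finrank_lt hrk b hiso)
  · exact hani (hq.isIsotropic_of_baseChange hrk hb hiso)
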